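/- For a prime $p$ and $k=\sum_r\kappa_r p^r\in\mathbb N_0$ (base-$p$ digits) put $\phi_p(k)=\sum_r\kappa_r p^{-r-1}$; for $x=\sum_{r\ge0}x_rp^{-r-1}\in[0,1)$ (finite expansion for $p$-adic rationals) put $\phi_p^+(x)=\sum_r x_rp^r\in\mathbb Z_p$. Let $\gamma_k(x)=\exp(2\pi i\,\phi_p(k)\,\phi_p^+(x))$, which is well defined because it only depends on $\phi_p^+(x)$ modulo a power $p^m>k$. Let $\rho_p(0)=1$ and $\rho_p(k)=p^{-2t}$ for $p^t\le k<p^{t+1}$. Let $s\ge1$ and let $\mathbf p=(p_1,\dots,p_s)$ be a vector of primes. For $\mathbf k\in\mathbb N_0^s$ and $\mathbf x\in[0,1)^s$ let $\gamma_{\mathbf k}(\mathbf x)=\prod_i\gamma_{k_i}(x_i)$ (the $i$-th factor in base $p_i$), $\rho_{\mathbf p}(\mathbf k)=\prod_i\rho_{p_i}(k_i)$ and $\sigma_{\mathbf p}=\prod_i(p_i+1)$. For integrable $f:[0,1)^s\to\mathbb C$ let $\widehat f(\mathbf k)=\int f\,\overline{\gamma_{\mathbf k}}\,d\mathbf x$,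 and let $$\langle f,g\rangle_{\mathbf p,s}=\sum_{\mathbf k}\rho_{\mathbf p}(\mathbf k)^{-1}\widehat f(\mathbf k)\overline{\widehat g(\mathbf k)},\qquad \|f\|_{\mathbf p,s}=\langle f,f\rangle_{\mathbf p,s}^{1/2}.$$ Let $\mathcal H_{\mathbf p,s}$ be the space of integrable functions $f$ with $\|f\|_{\mathbf p,s}<\infty$ and $f(\mathbf x)=\sum_{\mathbf k}\widehat f(\mathbf k)\gamma_{\mathbf k}(\mathbf x)$ for every $\mathbf x\in[0,1)^s$, with this inner product. Then: 1. $\mathcal H_{\mathbf p,s}$ is a Hilbert space; every integrable $f$ with $\|f\|_{\mathbf p,s}<\infty$ agrees almost everywhere with exactly one element of $\mathcal H_{\mathbf p,s}$; and $\mathcal H_{\mathbf p,s}=\mathcal H_{p_1}\otimes\dots\otimes\mathcal H_{p_s}$, where $\mathcal H_{p}=\mathcal H_{(p),1}$: all products $\prod_i f_i(x_i)$ with $f_i\in\mathcal H_{p_i}$ belong to it, inner products of such products are the products of the inner products, and their span is dense. 2. $\sum_{\mathbf k}\rho_{\mathbf p}(\mathbf k)<\infty$, and $K_{\mathbf p,s}(\mathbf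 x,\mathbf y)=\sum_{\mathbf k}\rho_{\mathbf p}(\mathbf k)\gamma_{\mathbf k}(\mathbf x)\overline{\gamma_{\mathbf k}(\mathbf y)}$ is the reproducing kernel of $\mathcal H_{\mathbf p,s}$. 3. For every sequence $\omega=(\mathbf x_n)_{n\ge0}$ in $[0,1)^s$ and every $N\ge1$, the worst-case error $$e(\mathcal H_{\mathbf p,s},\omega)=\sup_{f\in\mathcal H_{\mathbf p,s},\ \|f\|_{\mathbf p,s}\le1}\Big|\int_{[0,1]^s}f(\mathbf x)\,d\mathbf x-\frac1N\sum_{n=0}^{N-1}f(\mathbf x_n)\Big|$$ and the $\mathbf p$-adic diaphony $$F_N(\omega)=\Big(\frac1{\sigma_{\mathbf p}-1}\sum_{\mathbf k\ne\mathbf 0}\rho_{\mathbf p}(\mathbf k)\Big|\frac1N\sum_{n=0}^{N-1}\gamma_{\mathbf k}(\mathbf x_n)\Big|^2\Big)^{1/2}$$ satisfy $e(\mathcal H_{\mathbf p,s},\omega)=\sqrt{\sigma_{\mathbf p}-1}\;F_N(\omega)$. -/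

import Mathlib

open MeasureTheory Finset
open scoped ENNReal ComplexConjugate InnerProductSpace

noncomputable section

namespace PadicDiaphony

/-- The half-open unit cube `[0,1)^s`. -/
abbrev Cube (s : ℕ) : Type := Fin s → Set.Ico (0 : ℝ) 1

/-- `[0,1)` carries Lebesgue measure, and the cube the product measure. -/
instance : MeasureSpace (Set.Ico (0 : ℝ) 1) := Measure.Subtype.measureSpace

instance : IsProbabilityMeasure (volume : Measure (Set.Ico (0 : ℝ) 1)) where
  measure_univ := by
    change Measure.comap Subtype.val volume Set.univ = 1
    rw [comap_subtype_coe_apply measurableSet_Ico, Set.image_univ, Subtype.range_coe,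
      Real.volume_Ico]
    simp

instance factPrimes (q : Nat.Primes) : Fact (q : ℕ).Prime := ⟨q.2⟩

/-! ### The `p`-adic function system -/

section OneDim

variable (p : ℕ) [Fact p.Prime]

/-- The Monna map `φ_p` on nonnegative integers: `k = ∑ κ_r p^r` is sent to `∑ κ_r p^(-r-1)`. -/
def monna (k : ℕ) : ℝ :=
  ∑ r ∈ range (Nat.digits p k).length, ((k / p ^ r % p : ℕ) : ℝ) / (p : ℝ) ^ (r + 1)

/-- The map `φ_p⁺ : [0,1) → ℤ_p`, sending `x = ∑ x_r p^(-r-1)` to `∑ x_r p^r`. Here `Real.digits`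
takes `x_r = ⌊x p^(r+1)⌋ mod p`, so `p`-adic rationals get their finite expansion. -/
def monnaInv (x : Set.Ico (0 : ℝ) 1) : ℤ_[p] :=
  ∑' r : ℕ, ((Real.digits (x : ℝ) p r : ℕ) : ℤ_[p]) * (p : ℤ_[p]) ^ r

/-- The character `χ_k(z) = exp(2π i φ_p(k) z)` of `ℤ_p`. If `k` has `m` digits in base `p` then
`p^m φ_p(k)` is an integer, so that the right-hand side only depends on `z` modulo `p^m`. -/
def chi (k : ℕ) (z : ℤ_[p]) : ℂ :=
  Complex.exp (2 * Real.pi * Complex.I *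
    ((monna p k * ((PadicInt.toZModPow (Nat.digits p k).length z).val : ℝ) : ℝ) : ℂ))

/-- The `k`-th `p`-adic function `γ_k = χ_k ∘ φ_p⁺` on `[0,1)`. -/
def gammaOne (k : ℕ) (x : Set.Ico (0 : ℝ) 1) : ℂ := chi p k (monnaInv p x)

/-- The weights `ρ_p(0) = 1` and `ρ_p(k) = p^(-2t)` if `p^t ≤ k < p^(t+1)`. -/
def rhoOne (k : ℕ) : ℝ := if k = 0 then 1 else ((p : ℝ) ^ (2 * Nat.log p k))⁻¹

lemma norm_gammaOne (k : ℕ) (x : Set.Ico (0 : ℝ) 1) : ‖gammaOne p k x‖ = 1 := by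
  unfold gammaOne chi
  rw [show ∀ t : ℝ, (2 * Real.pi * Complex.I * (t : ℂ)) = ((2 * Real.pi * t : ℝ) : ℂ) * Complex.I
    from fun t => by push_cast; ring]
  exact Complex.norm_exp_ofReal_mul_I _

lemma rhoOne_pos (k : ℕ) : 0 < rhoOne p k := by
  have : 0 < (p : ℝ) := by exact_mod_cast (Fact.out : p.Prime).pos
  unfold rhoOne
  split_ifs <;> positivity

lemma summable_digits (d : ℕ → ℕ) : Summable fun r : ℕ => (d r : ℤ_[p]) * (p : ℤ_[p]) ^ r := by
  have hp : (1 : ℝ) < p := by exact_mod_cast (Fact.out : p.Prime).one_lt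
  refine Summable.of_norm_bounded (g := fun r : ℕ => ((p : ℝ)⁻¹) ^ r)
    (summable_geometric_of_lt_one (by positivity) (inv_lt_one_of_one_lt₀ hp)) fun r => ?_
  rw [norm_mul, norm_pow, PadicInt.norm_p]
  exact mul_le_of_le_one_left (by positivity) (PadicInt.norm_le_one _)

/-- Modulo `p^m`, only the first `m` digits matter. -/
lemma toZModPow_monnaInv (m : ℕ) (x : Set.Ico (0 : ℝ) 1) :
    PadicInt.toZModPow m (monnaInv p x) =
      ∑ r ∈ range m, ((Real.digits (x : ℝ) p r : ℕ) : ZMod (p ^ m)) * (p : ZMod (p ^ m)) ^ r := by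
  have h := (summable_digits p fun r => (Real.digits (x : ℝ) p r : ℕ)).sum_add_tsum_nat_add m
  have h2 : ∑' r : ℕ, ((Real.digits (x : ℝ) p (r + m) : ℕ) : ℤ_[p]) * (p : ℤ_[p]) ^ (r + m) =
      (p : ℤ_[p]) ^ m * ∑' r : ℕ, ((Real.digits (x : ℝ) p (r + m) : ℕ) : ℤ_[p]) *
        (p : ℤ_[p]) ^ r := by
    rw [← (summable_digits p fun r => (Real.digits (x : ℝ) p (r + m) : ℕ)).tsum_mul_left]
    exact tsum_congr fun r => by ring
  have h3 : ((p : ZMod (p ^ m))) ^ m = 0 := by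
    exact_mod_cast ZMod.natCast_self (p ^ m)
  unfold monnaInv
  rw [← h, h2]
  simp [h3]

lemma measurable_gammaOne (k : ℕ) : Measurable (gammaOne p k) := by
  unfold gammaOne chi
  simp only [toZModPow_monnaInv]
  generalize (Nat.digits p k).length = m
  have h : Measurable fun x : Set.Ico (0 : ℝ) 1 =>
      ∑ r ∈ range m, (((Real.digits (x : ℝ) p r : ℕ) : ZMod (p ^ m)) * (p : ZMod (p ^ m)) ^ r).val := by
    refine Finset.measurable_sum _ fun r _ => ?_
    have : Measurable fun x : Set.Ico (0 : ℝ) 1 => ⌊(x : ℝ) * (p : ℝ) ^ (r + 1)⌋₊ :=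
      Nat.measurable_floor.comp (by fun_prop)
    exact (measurable_from_top (f := fun j : ℕ =>
      (((Fin.ofNat p j : ℕ) : ZMod (p ^ m)) * (p : ZMod (p ^ m)) ^ r).val)).comp this
  have h' : Measurable fun x : Set.Ico (0 : ℝ) 1 =>
      (∑ r ∈ range m, ((Real.digits (x : ℝ) p r : ℕ) : ZMod (p ^ m)) *
        (p : ZMod (p ^ m)) ^ r).val := by
    have e := (measurable_from_top (f := fun j : ℕ => ((j : ℕ) : ZMod (p ^ m)).val)).comp h
    have : NeZero (p ^ m) := ⟨pow_ne_zero _ (Fact.out : p.Prime).ne_zero⟩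
    refine (congrArg Measurable (funext fun x => ?_)).mp e
    change ZMod.val ((∑ r ∈ range m, (((Real.digits (x : ℝ) p r : ℕ) : ZMod (p ^ m)) *
      (p : ZMod (p ^ m)) ^ r).val : ℕ) : ZMod (p ^ m)) = _
    rw [Nat.cast_sum]
    exact congrArg ZMod.val (Finset.sum_congr rfl fun r _ => ZMod.natCast_zmod_val _)
  have h4 := (measurable_from_top (f := fun j : ℕ =>
    Complex.exp (2 * Real.pi * Complex.I * ((monna p k * (j : ℝ) : ℝ) : ℂ)))).comp h'
  exact h4

end OneDim

variable {s : ℕ} (p : Fin s → Nat.Primes)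

/-- The `k`-th `p`-adic function on `[0,1)^s`, for a vector `p` of primes. -/
def gamma (k : Fin s → ℕ) (x : Cube s) : ℂ := ∏ i, gammaOne (p i) (k i) (x i)

/-- The weights `ρ_p(k) = ∏ ρ_{p_i}(k_i)`. -/
def rho (k : Fin s → ℕ) : ℝ := ∏ i, rhoOne (p i) (k i)

/-- The constant `σ_p = ∏ (p_i + 1)`. -/
def sigma : ℝ := ∏ i, (((p i : ℕ) : ℝ) + 1)

lemma norm_gamma (k : Fin s → ℕ) (x : Cube s) : ‖gamma p k x‖ = 1 := by
  simp [gamma, norm_gammaOne]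

lemma rho_pos (k : Fin s → ℕ) : 0 < rho p k := prod_pos fun _ _ => rhoOne_pos _ _

lemma measurable_gamma (k : Fin s → ℕ) : Measurable (gamma p k) :=
  Finset.measurable_prod _ fun i _ => (measurable_gammaOne (p i) (k i)).comp (measurable_pi_apply i)

/-- The `p`-adic diaphony `F_N(ω)`. -/
def diaphony (ω : ℕ → Cube s) (N : ℕ) : ℝ :=
  Real.sqrt (1 / (sigma p - 1) * ∑' k : {k : Fin s → ℕ // k ≠ 0},
    rho p k * ‖(1 / (N : ℂ)) * ∑ n ∈ range N, gamma p k (ω n)‖ ^ 2)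

/-- The kernel `K_{p,s}(x,y)`. -/
def kernel (x y : Cube s) : ℂ := ∑' k : Fin s → ℕ, (rho p k : ℂ) * gamma p k x * conj (gamma p k y)

/-! ### The space `H_{p,s}` -/

/-- The coefficient `f̂(k)`, the integral of `f` times the conjugate of `γ_k` over the cube. -/
def coeff (f : Cube s → ℂ) (k : Fin s → ℕ) : ℂ := ∫ x, f x * conj (gamma p k x)

/-- `‖f‖_{p,s} < ∞`, that is, `∑ ρ_p(k)⁻¹ |f̂(k)|² < ∞`. -/
def FiniteNorm (f : Cube s → ℂ) : Prop :=
  Summable fun k : Fin s → ℕ => (rho p k)⁻¹ * ‖coeff p f k‖ ^ 2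

lemma integrable_mul_gamma {f : Cube s → ℂ} (hf : Integrable f) (k : Fin s → ℕ) :
    Integrable fun x => f x * conj (gamma p k x) := by
  refine hf.mul_bdd (c := 1) ?_ ?_
  · exact (Complex.continuous_conj.measurable.comp (measurable_gamma p k)).aestronglyMeasurable
  · exact Filter.Eventually.of_forall fun x => by simp [norm_gamma]

lemma coeff_add {f g : Cube s → ℂ} (hf : Integrable f) (hg : Integrable g) (k : Fin s → ℕ) :
    coeff p (f + g) k = coeff p f k + coeff p g k := by
  simp only [coeff, Pi.add_apply, add_mul]
  exact integral_add (integrable_mul_gamma p hf k) (integrable_mul_gamma p hg k)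

lemma coeff_smul (c : ℂ) (f : Cube s → ℂ) (k : Fin s → ℕ) :
    coeff p (c • f) k = c * coeff p f k := by
  simp only [coeff, Pi.smul_apply, smul_eq_mul, mul_assoc]
  exact integral_const_mul _ _

lemma FiniteNorm.summable_inner {f g : Cube s → ℂ} (hf : FiniteNorm p f) (hg : FiniteNorm p g) :
    Summable fun k : Fin s → ℕ => ((rho p k)⁻¹ : ℂ) * (coeff p g k * conj (coeff p f k)) := by
  refine Summable.of_norm_bounded (hf.add hg) fun k => ?_
  have h := inv_pos.mpr (rho_pos p k)
  have e : ‖((rho p k)⁻¹ : ℂ)‖ = (rho p k)⁻¹ := by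
    rw [norm_inv, Complex.norm_real, Real.norm_of_nonneg (rho_pos p k).le]
  rw [norm_mul, norm_mul, RCLike.norm_conj, e, ← mul_add]
  refine mul_le_mul_of_nonneg_left ?_ h.le
  nlinarith [sq_nonneg (‖coeff p f k‖ - ‖coeff p g k‖), sq_nonneg ‖coeff p f k‖,
    sq_nonneg ‖coeff p g k‖]

/-- The functions on `[0,1)^s` of finite norm. The norm only sees `f` up to null sets; as the space
consists of functions with point values, every class is represented by the function which equals
its `p`-adic series at each point. -/
def submodule : Submodule ℂ (Cube s → ℂ) where
  carrier := {f | Integrable f ∧ FiniteNorm p f ∧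
    ∀ x, HasSum (fun k : Fin s → ℕ => coeff p f k * gamma p k x) (f x)}
  zero_mem' := by
    have : coeff p (0 : Cube s → ℂ) = 0 := by
      funext k; simp [coeff]
    refine ⟨integrable_zero _ _ _, ?_, fun x => ?_⟩
    · simp [FiniteNorm, this, summable_zero]
    · simp [this, hasSum_zero]
  add_mem' := by
    rintro f g ⟨hf, hf', hf''⟩ ⟨hg, hg', hg''⟩
    refine ⟨hf.add hg, ?_, fun x => ?_⟩
    · refine Summable.of_nonneg_of_le (fun k => ?_) (fun k => ?_) ((hf'.add hg').mul_left 2)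
      · have := rho_pos p k
        positivity
      · rw [coeff_add p hf hg, ← mul_add, mul_left_comm]
        refine mul_le_mul_of_nonneg_left ?_ (inv_pos.mpr (rho_pos p k)).le
        have h1 := norm_add_le (coeff p f k) (coeff p g k)
        have h2 := norm_nonneg (coeff p f k + coeff p g k)
        nlinarith [sq_nonneg (‖coeff p f k‖ - ‖coeff p g k‖)]
    · simp only [coeff_add p hf hg, add_mul]
      exact (hf'' x).add (hg'' x)
  smul_mem' := by
    rintro c f ⟨hf, hf', hf''⟩
    refine ⟨hf.smul c, ?_, fun x => ?_⟩
    · refine (hf'.mul_left (‖c‖ ^ 2)).congr fun k => ?_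
      rw [coeff_smul, norm_mul]
      ring
    · simp only [coeff_smul, mul_assoc]
      exact (hf'' x).mul_left c

/-- The space `H_{p,s}`, with the inner product `⟨f, g⟩ = ∑ ρ_p(k)⁻¹ f̂(k) conj(ĝ(k))`. -/
def HSpace : Type := submodule p

instance : AddCommGroup (HSpace p) := inferInstanceAs (AddCommGroup (submodule p))

instance : Module ℂ (HSpace p) := inferInstanceAs (Module ℂ (submodule p))

instance : FunLike (HSpace p) (Cube s) ℂ where
  coe f := f.1
  coe_injective f g h := Subtype.ext h

lemma HSpace.spec (f : HSpace p) : Integrable (f : Cube s → ℂ) ∧ FiniteNorm p f ∧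
    ∀ x, HasSum (fun k : Fin s → ℕ => coeff p f k * gamma p k x) (f x) := f.2

lemma HSpace.coe_add (f g : HSpace p) : ((f + g : HSpace p) : Cube s → ℂ) = f + g := rfl

lemma HSpace.coe_smul (c : ℂ) (f : HSpace p) : ((c • f : HSpace p) : Cube s → ℂ) = c • ⇑f := rfl

/-- Mathlib's inner product is linear in the second argument, so `⟪g, f⟫` is `⟨f, g⟩` above. -/
@[reducible] def core : InnerProductSpace.Core ℂ (HSpace p) where
  inner g f := ∑' k : Fin s → ℕ, ((rho p k)⁻¹ : ℂ) * (coeff p f k * conj (coeff p g k))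
  conj_inner_symm _ _ := by
    rw [Complex.conj_tsum]
    refine tsum_congr fun k => ?_
    simp [mul_comm]
  re_inner_nonneg f := by
    rw [show (∑' k : Fin s → ℕ, ((rho p k)⁻¹ : ℂ) * (coeff p f k * conj (coeff p f k))) =
      ((∑' k : Fin s → ℕ, (rho p k)⁻¹ * ‖coeff p f k‖ ^ 2 : ℝ) : ℂ) by
        rw [Complex.ofReal_tsum]
        exact tsum_congr fun k => by rw [Complex.mul_conj']; push_cast; rfl]
    refine tsum_nonneg fun k => ?_
    have := rho_pos p k
    positivity
  add_left f g h := by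
    rw [← (FiniteNorm.summable_inner p f.spec.2.1 h.spec.2.1).tsum_add
      (FiniteNorm.summable_inner p g.spec.2.1 h.spec.2.1)]
    refine tsum_congr fun k => ?_
    rw [HSpace.coe_add, coeff_add p f.spec.1 g.spec.1, map_add]
    ring
  smul_left f g c := by
    rw [← tsum_mul_left]
    refine tsum_congr fun k => ?_
    rw [HSpace.coe_smul, coeff_smul, map_mul]
    ring
  definite f hf := by
    have e : (∑' k : Fin s → ℕ, ((rho p k)⁻¹ : ℂ) * (coeff p f k * conj (coeff p f k))) =
      ((∑' k : Fin s → ℕ, (rho p k)⁻¹ * ‖coeff p f k‖ ^ 2 : ℝ) : ℂ) := by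
        rw [Complex.ofReal_tsum]
        exact tsum_congr fun k => by rw [Complex.mul_conj']; push_cast; rfl
    have h0 : (∑' k : Fin s → ℕ, (rho p k)⁻¹ * ‖coeff p f k‖ ^ 2) = 0 := by
      have := e.symm.trans hf
      exact_mod_cast this
    have hnn : ∀ k, 0 ≤ (rho p k)⁻¹ * ‖coeff p f k‖ ^ 2 := fun k => by
      have := rho_pos p k
      positivity
    have h1 := (hasSum_zero_iff_of_nonneg hnn).mp (h0 ▸ f.spec.2.1.hasSum)
    have h2 : ∀ k, coeff p f k = 0 := fun k => by
      have h3 := congrFun h1 k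
      have := (rho_pos p k).ne'
      simpa [this] using h3
    refine DFunLike.ext _ _ fun x => ?_
    have h4 := f.spec.2.2 x
    simp only [h2, zero_mul] at h4
    exact h4.unique hasSum_zero

instance : NormedAddCommGroup (HSpace p) := (core p).toNormedAddCommGroup

instance : InnerProductSpace ℂ (HSpace p) := InnerProductSpace.ofCore (core p).toCore

/-! ### Reproducing kernels, tensor products and worst-case errors -/

/-- `K` is the reproducing kernel of the space `H` of functions on `X`: for each `y`, the function
`K(·, y)` belongs to `H` and represents the evaluation at `y`. -/
def IsReproducingKernel {X : Type*} (H : Type*) [NormedAddCommGroup H] [InnerProductSpace ℂ H]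
    [FunLike H X ℂ] (K : X → X → ℂ) : Prop :=
  ∀ y, ∃ g : H, (∀ x, g x = K x y) ∧ ∀ f : H, ⟪g, f⟫_ℂ = f y

/-- The one-dimensional space `H_q`, for a prime `q`. -/
abbrev HOne (q : Nat.Primes) : Type := HSpace fun _ : Fin 1 => q

/-- `F` is the function `x ↦ f_1(x_1) ⋯ f_s(x_s)`. -/
def IsPureTensor (f : ∀ i, HOne (p i)) (F : HSpace p) : Prop :=
  ∀ x : Cube s, F x = ∏ i, f i fun _ => x i

/-- `H_{p,s} = H_{p_1} ⊗ ⋯ ⊗ H_{p_s}` as Hilbert spaces of functions: all product functions belong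
to `H_{p,s}`, inner products of product functions are the products of the inner products, and the
product functions span a dense subspace (completeness is stated separately). -/
def IsTensorProduct : Prop :=
  (∀ f : ∀ i, HOne (p i), ∃ F : HSpace p, IsPureTensor p f F) ∧
  (∀ (f g : ∀ i, HOne (p i)) (F G : HSpace p), IsPureTensor p f F → IsPureTensor p g G →
    ⟪F, G⟫_ℂ = ∏ i, ⟪f i, g i⟫_ℂ) ∧
  Dense (Submodule.span ℂ {F : HSpace p | ∃ f, IsPureTensor p f F} : Set (HSpace p))

/-- The worst-case error `e(H, ω)` of the quasi-Monte Carlo rule based on the first `N` points of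
`ω`, over the unit ball of a normed space `H` of functions on the cube. The supremum is taken in
`[0, ∞]`, so that it needs no boundedness. -/
def worstCaseError (H : Type*) [NormedAddCommGroup H] [FunLike H (Cube s) ℂ]
    (ω : ℕ → Cube s) (N : ℕ) : ℝ≥0∞ :=
  ⨆ (f : H) (_ : ‖f‖ ≤ 1),
    ENNReal.ofReal ‖(∫ x, f x) - (1 / (N : ℂ)) * ∑ n ∈ range N, f (ω n)‖

end PadicDiaphony

end

/-!
The functions `γ_k` form an orthonormal system on the cube which determines integrable functions,
and the space `H_{p,s}` is the weighted `ℓ²` space of the coefficients with respect to it. All the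
claims are read off from this description.

*The system in one dimension.* Modulo `p^m`, the value `φ_p⁺(x)` is the residue formed by the first
`m` digits of `x`. Points with equal residue differ by at most `p^(-m)`, and there are `p^m`
residues, so each of them is taken with probability exactly `p^(-m)` (`volume_residue`). For
`k < p^m` the function `γ_k` is a character of `ℤ/p^m` evaluated at this residue, and digit reversal
makes `k ↦ γ_k` a bijection onto the characters (`gammaOne_eq_stdAddChar`, `rev_injOn`).
Orthogonality of characters gives orthonormality (`integral_gammaOne_mul_conj`), and Fourier
inversion on `ℤ/p^m` writes the indicator of a cell, the set of points with a given residue, as a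
combination of the `γ_k` (`indicator_residue`).

*The cube.* Orthonormality follows by Fubini. Products of cells are a `π`-system generating the
Borel sets, and their indicators are combinations of the `γ_k`, so an integrable function with
vanishing coefficients is zero almost everywhere (`ae_eq_zero_of_coeff_eq_zero`).

*The space.* As `∑ ρ(k) < ∞`, a family `c` with `∑ ρ(k)⁻¹ |c_k|² < ∞` is absolutely summable, so
`∑ c_k γ_k` converges uniformly to an element of the space with coefficients `c`
(`HSpace.exists_coeff_eq`). Hence the space is isometric to `ℓ²`, and every integrable function of
finite norm has exactly one representative in it. The coefficients of a product function are
products of coefficients, so the statements on product functions reduce to multiplying absolutely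
convergent series (`summable_norm_and_hasSum_prod`), and the product functions include all the
`γ_k`, which are total. The kernel `K(·, y)` has coefficients `ρ(k) conj(γ_k(y))`. Finally, the
quadrature error is the inner product with the function with coefficients `-ρ(k) conj(S_k)`, `k ≠ 0`,
where `S_k` is the mean of `γ_k` over the points; the worst-case error is the norm of that function,
and its square is the sum in the diaphony (`exists_representer`).
-/

noncomputable section

namespace PadicDiaphony

/-! ### Residues: the distribution of the leading digits -/

lemma sum_mul_pow_lt {p : ℕ} (d : ℕ → Fin p) (m : ℕ) :
    ∑ r ∈ range m, (d r : ℕ) * p ^ r < p ^ m := by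
  induction m with
  | zero => simp
  | succ m ih =>
    rw [sum_range_succ, pow_succ]
    have h : (d m : ℕ) + 1 ≤ p := (d m).2
    nlinarith [Nat.mul_le_mul_right (p ^ m) h]

section OneDimensional

variable (p : ℕ) [Fact p.Prime]

/-- The first `m` digits of `x`, packed as the residue `∑_{r < m} x_r p^r` of `φ_p⁺(x)`
modulo `p^m`. -/
def residue (m : ℕ) (x : Set.Ico (0 : ℝ) 1) : ZMod (p ^ m) :=
  PadicInt.toZModPow m (monnaInv p x)

lemma val_residue (m : ℕ) (x : Set.Ico (0 : ℝ) 1) :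
    (residue p m x).val = ∑ r ∈ range m, (Real.digits (x : ℝ) p r : ℕ) * p ^ r := by
  have h : residue p m x =
      ((∑ r ∈ range m, (Real.digits (x : ℝ) p r : ℕ) * p ^ r : ℕ) : ZMod (p ^ m)) := by
    rw [residue, toZModPow_monnaInv]
    push_cast
    rfl
  rw [h, ZMod.val_natCast, Nat.mod_eq_of_lt (sum_mul_pow_lt _ m)]

lemma digits_eq_residue_div (r : ℕ) (x : Set.Ico (0 : ℝ) 1) :
    (Real.digits (x : ℝ) p r : ℕ) = (residue p (r + 1) x).val / p ^ r := by
  have hp : 0 < p ^ r := pow_pos (Fact.out : p.Prime).pos r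
  rw [val_residue, sum_range_succ, Nat.add_mul_div_right _ _ hp,
    Nat.div_eq_of_lt (sum_mul_pow_lt _ r), zero_add]

lemma cast_residue {m n : ℕ} (h : m ≤ n) (x : Set.Ico (0 : ℝ) 1) :
    ((residue p n x).cast : ZMod (p ^ m)) = residue p m x :=
  PadicInt.cast_toZModPow m n h _

lemma measurableSet_residue (m : ℕ) (z : ZMod (p ^ m)) :
    MeasurableSet {x : Set.Ico (0 : ℝ) 1 | residue p m x = z} := by
  have h : Measurable fun x : Set.Ico (0 : ℝ) 1 => (residue p m x).val := by
    simp only [val_residue]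
    refine Finset.measurable_sum _ fun r _ => ?_
    have : Measurable fun x : Set.Ico (0 : ℝ) 1 => ⌊(x : ℝ) * (p : ℝ) ^ (r + 1)⌋₊ :=
      Nat.measurable_floor.comp (by fun_prop)
    exact (measurable_from_top (f := fun j : ℕ => (Fin.ofNat p j : ℕ) * p ^ r)).comp this
  have e : {x : Set.Ico (0 : ℝ) 1 | residue p m x = z} =
      (fun x => (residue p m x).val) ⁻¹' {z.val} := by
    ext x
    exact (ZMod.val_injective _).eq_iff.symm
  rw [e]
  exact h (measurableSet_singleton _)

lemma sub_le_of_residue_eq {m : ℕ} {x y : Set.Ico (0 : ℝ) 1} (h : residue p m x = residue p m y) :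
    |(x : ℝ) - y| ≤ ((p : ℝ) ^ m)⁻¹ := by
  have hp := (Fact.out : p.Prime).one_lt
  rw [← Real.ofDigits_digits hp x.2, ← Real.ofDigits_digits hp y.2]
  refine Real.abs_ofDigits_sub_ofDigits_le fun r hr => Fin.ext ?_
  rw [digits_eq_residue_div, digits_eq_residue_div, ← cast_residue p (Nat.succ_le_of_lt hr),
    ← cast_residue p (Nat.succ_le_of_lt hr), h]

lemma volume_residue_le (m : ℕ) (z : ZMod (p ^ m)) :
    volume {x : Set.Ico (0 : ℝ) 1 | residue p m x = z} ≤ ((p : ℝ≥0∞) ^ m)⁻¹ := by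
  have e : volume {x : Set.Ico (0 : ℝ) 1 | residue p m x = z} =
      volume (Subtype.val '' {x : Set.Ico (0 : ℝ) 1 | residue p m x = z}) :=
    comap_subtype_coe_apply measurableSet_Ico volume _
  rw [e]
  refine (Real.volume_le_diam _).trans (Metric.ediam_le ?_)
  rintro _ ⟨x, hx, rfl⟩ _ ⟨y, hy, rfl⟩
  have h := sub_le_of_residue_eq p (hx.trans hy.symm)
  have h0 : (0 : ℝ) < (p : ℝ) ^ m := by
    have := (Fact.out : p.Prime).pos
    positivity
  rw [edist_dist, Real.dist_eq]
  refine (ENNReal.ofReal_le_ofReal h).trans_eq ?_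
  rw [ENNReal.ofReal_inv_of_pos h0, ENNReal.ofReal_pow (by positivity), ENNReal.ofReal_natCast]

/-- The residues are uniformly distributed: there are `p^m` of them, and each is taken on a set of
diameter, hence of measure, at most `p^(-m)`, so that all these measures equal `p^(-m)`. -/
lemma volume_residue (m : ℕ) (z : ZMod (p ^ m)) :
    volume {x : Set.Ico (0 : ℝ) 1 | residue p m x = z} = ((p : ℝ≥0∞) ^ m)⁻¹ := by
  have h1 : ∑ z : ZMod (p ^ m), volume {x : Set.Ico (0 : ℝ) 1 | residue p m x = z} = 1 := by
    rw [← measure_biUnion_finset]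
    · rw [← measure_univ (μ := (volume : Measure (Set.Ico (0 : ℝ) 1)))]
      congr 1
      ext x
      simp
    · intro a _ b _ hab
      exact Set.disjoint_left.mpr fun x ha hb => hab (ha.symm.trans hb)
    · exact fun z _ => measurableSet_residue p m z
  have h2 : ∑ _z : ZMod (p ^ m), ((p : ℝ≥0∞) ^ m)⁻¹ = 1 := by
    have h0 : (p : ℝ≥0∞) ^ m ≠ 0 :=
      pow_ne_zero _ (by exact_mod_cast (Fact.out : p.Prime).ne_zero)
    rw [sum_const, card_univ, ZMod.card, nsmul_eq_mul, Nat.cast_pow,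
      ENNReal.mul_inv_cancel h0 (by finiteness)]
  refine le_antisymm (volume_residue_le p m z) ?_
  have h3 : ∑ _w ∈ univ.erase z, ((p : ℝ≥0∞) ^ m)⁻¹ ≠ ∞ :=
    ((sum_le_univ_sum_of_nonneg fun _ => zero_le).trans_eq h2).trans_lt ENNReal.one_lt_top |>.ne
  refine (ENNReal.add_le_add_iff_right h3).mp ?_
  rw [add_sum_erase univ (fun _ => ((p : ℝ≥0∞) ^ m)⁻¹) (mem_univ z), h2, ← h1,
    ← add_sum_erase univ _ (mem_univ z)]
  exact add_le_add_right (sum_le_sum fun w _ => volume_residue_le p m w) _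

lemma integral_comp_residue (m : ℕ) (g : ZMod (p ^ m) → ℂ) :
    ∫ x, g (residue p m x) = ((p : ℂ) ^ m)⁻¹ * ∑ z, g z := by
  have e : ∀ x, g (residue p m x) =
      ∑ z, {x : Set.Ico (0 : ℝ) 1 | residue p m x = z}.indicator (fun _ => g z) x := by
    intro x
    rw [sum_eq_single (residue p m x)]
    · simp
    · intro z _ hz
      exact Set.indicator_of_notMem (fun h => hz h.symm) _
    · simp
  simp only [e]
  rw [integral_finsetSum _ fun z _ =>
    (integrable_const _).indicator (measurableSet_residue p m z), mul_sum]
  refine sum_congr rfl fun z _ => ?_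
  rw [integral_indicator_const _ (measurableSet_residue p m z), measureReal_def, volume_residue]
  simp

/-! ### The functions `γ_k` as characters of `ℤ/p^m` -/

/-- The reversal `∑_{r < m} κ_{m-1-r} p^r` of the first `m` digits of `k = ∑ κ_r p^r`. -/
def rev : ℕ → ℕ → ℕ
  | 0, _ => 0
  | m + 1, k => k % p * p ^ m + rev m (k / p)

lemma rev_lt (m k : ℕ) : rev p m k < p ^ m := by
  induction m generalizing k with
  | zero => simp [rev]
  | succ m ih =>
    have h : k % p + 1 ≤ p := Nat.mod_lt _ (Fact.out : p.Prime).pos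
    have := ih (k / p)
    rw [rev, pow_succ]
    nlinarith [Nat.mul_le_mul_right (p ^ m) h]

lemma rev_injOn (m : ℕ) : Set.InjOn (rev p m) (Set.Iio (p ^ m)) := by
  induction m with
  | zero =>
    intro k hk l hl _
    simp_all
  | succ m ih =>
    intro k hk l hl h
    have hp := (Fact.out : p.Prime).pos
    have hpm : 0 < p ^ m := pow_pos hp m
    have hk' : k / p < p ^ m := Nat.div_lt_of_lt_mul (by rw [← pow_succ']; exact hk)
    have hl' : l / p < p ^ m := Nat.div_lt_of_lt_mul (by rw [← pow_succ']; exact hl)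
    have h1 : k % p = l % p := by
      have := congrArg (· / p ^ m) h
      simpa [rev, Nat.mul_add_div, mul_comm _ (p ^ m), hpm, Nat.div_eq_of_lt (rev_lt p m _)]
        using this
    have h2 : k / p = l / p := ih hk' hl' (by simpa [rev, h1] using h)
    rw [← Nat.div_add_mod k p, ← Nat.div_add_mod l p, h1, h2]

lemma rev_eq_sum (m k : ℕ) :
    (rev p m k : ℝ) =
      (p : ℝ) ^ m * ∑ r ∈ range m, ((k / p ^ r % p : ℕ) : ℝ) / (p : ℝ) ^ (r + 1) := by
  have hp : (p : ℝ) ≠ 0 := by exact_mod_cast (Fact.out : p.Prime).ne_zero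
  induction m generalizing k with
  | zero => simp [rev]
  | succ m ih =>
    rw [rev, sum_range_succ']
    push_cast
    rw [ih, mul_add, mul_sum, mul_sum, add_comm]
    congr 1
    · refine sum_congr rfl fun r _ => ?_
      rw [Nat.div_div_eq_div_mul, ← pow_succ']
      field_simp
      ring
    · simp only [pow_zero, Nat.div_one, pow_one]
      field_simp
      ring

lemma monna_eq_rev_div {m k : ℕ} (h : k < p ^ m) : monna p k = rev p m k / (p : ℝ) ^ m := by
  have hp : (p : ℝ) ≠ 0 := by exact_mod_cast (Fact.out : p.Prime).ne_zero
  rw [rev_eq_sum, mul_div_cancel_left₀ _ (pow_ne_zero _ hp), monna]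
  refine sum_subset (range_mono ?_) fun r _ hr => ?_
  · exact (Nat.digits_length_le_iff (Fact.out : p.Prime).one_lt k).mpr h
  · have hk : k < p ^ r := (Nat.digits_length_le_iff (Fact.out : p.Prime).one_lt k).mp
      (by simpa using hr)
    simp [Nat.div_eq_of_lt hk]

/-- For `k < p^m` the function `γ_k` is a character of `ℤ/p^m`, evaluated at the residue; the
index of this character is the digit reversal of `k`. -/
lemma gammaOne_eq_stdAddChar {m k : ℕ} (h : k < p ^ m) (x : Set.Ico (0 : ℝ) 1) :
    gammaOne p k x = ZMod.stdAddChar ((rev p m k : ZMod (p ^ m)) * residue p m x) := by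
  have hp : (p : ℂ) ≠ 0 := by exact_mod_cast (Fact.out : p.Prime).ne_zero
  set n := (Nat.digits p k).length with hn
  have hnm : n ≤ m := (Nat.digits_length_le_iff (Fact.out : p.Prime).one_lt k).mpr h
  have hkn : k < p ^ n := (Nat.digits_length_le_iff (Fact.out : p.Prime).one_lt k).mp le_rfl
  have e : (rev p m k : ZMod (p ^ m)) * residue p m x =
      (((rev p m k : ℤ) * (residue p m x).val : ℤ) : ZMod (p ^ m)) := by
    push_cast
    rw [ZMod.natCast_zmod_val]
  rw [e, ZMod.stdAddChar_coe, gammaOne, chi, ← hn, Complex.exp_eq_exp_iff_exists_int]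
  -- The residues modulo `p^n` and `p^m` differ by a multiple of `p^n`.
  have hc : (((residue p m x).val : ℤ) : ZMod (p ^ n)) = (((residue p n x).val : ℤ) : ZMod _) := by
    push_cast
    rw [ZMod.natCast_zmod_val, ← cast_residue p hnm, ZMod.natCast_val]
  obtain ⟨c, hc⟩ := (ZMod.intCast_eq_intCast_iff_dvd_sub _ _ _).mp hc
  refine ⟨rev p n k * c, ?_⟩
  have h1 : ((residue p n x).val : ℂ) - (residue p m x).val = (p : ℂ) ^ n * c := by
    exact_mod_cast hc
  have h2 : (rev p m k : ℂ) / (p : ℂ) ^ m = (rev p n k : ℂ) / (p : ℂ) ^ n := by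
    have := (monna_eq_rev_div p h).symm.trans (monna_eq_rev_div p hkn)
    have := congrArg Complex.ofReal this
    push_cast at this
    exact this
  rw [monna_eq_rev_div p hkn]
  change _ * ((_ * ((residue p n x).val : ℝ) : ℝ) : ℂ) = _
  push_cast
  have h3 : ((residue p n x).val : ℂ) = (residue p m x).val + (p : ℂ) ^ n * c := by
    rw [← h1]; ring
  calc _ = 2 * Real.pi * Complex.I * ((rev p n k : ℂ) / (p : ℂ) ^ n * (residue p m x).val) +
        2 * Real.pi * Complex.I * (rev p n k * c) * ((p : ℂ) ^ n / (p : ℂ) ^ n) := by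
          rw [h3]; ring
    _ = _ := by
          rw [div_self (pow_ne_zero _ hp), ← h2]; ring

lemma conj_stdAddChar {N : ℕ} [NeZero N] (a : ZMod N) :
    conj (ZMod.stdAddChar a) = ZMod.stdAddChar (-a) := by
  rw [AddChar.map_neg_eq_conj]

lemma sum_stdAddChar_mul {N : ℕ} [NeZero N] (a : ZMod N) :
    ∑ z : ZMod N, ZMod.stdAddChar (a * z) = if a = 0 then (N : ℂ) else 0 := by
  simpa [mul_comm] using AddChar.sum_mulShift a (ZMod.isPrimitive_stdAddChar N)

lemma integral_gammaOne_mul_conj (k l : ℕ) :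
    ∫ x, gammaOne p l x * conj (gammaOne p k x) = if k = l then 1 else 0 := by
  have hp : (p : ℂ) ≠ 0 := by exact_mod_cast (Fact.out : p.Prime).ne_zero
  obtain ⟨m, hm⟩ : ∃ m, max k l < p ^ m := ⟨_, Nat.lt_pow_self (Fact.out : p.Prime).one_lt⟩
  have hk := (le_max_left k l).trans_lt hm
  have hl := (le_max_right k l).trans_lt hm
  have e : ∀ x, gammaOne p l x * conj (gammaOne p k x) =
      ZMod.stdAddChar (((rev p m l : ZMod (p ^ m)) - (rev p m k : ZMod (p ^ m))) *
        residue p m x) := fun x => by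
    rw [gammaOne_eq_stdAddChar p hk, gammaOne_eq_stdAddChar p hl, conj_stdAddChar,
      ← AddChar.map_add_eq_mul]
    congr 1
    ring
  simp only [e]
  rw [integral_comp_residue p m fun z =>
    ZMod.stdAddChar (((rev p m l : ZMod (p ^ m)) - (rev p m k : ZMod (p ^ m))) * z), sum_stdAddChar_mul]
  have h : (rev p m l : ZMod (p ^ m)) - (rev p m k : ZMod (p ^ m)) = 0 ↔ k = l := by
    rw [sub_eq_zero, ZMod.natCast_eq_natCast_iff', Nat.mod_eq_of_lt (rev_lt p m l),
      Nat.mod_eq_of_lt (rev_lt p m k)]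
    exact ⟨fun h => (rev_injOn p m hl hk h).symm, fun h => by rw [h]⟩
  simp only [h]
  split_ifs <;> simp [hp]

/-- Fourier inversion on `ℤ/p^m`: the indicator function of a cell of residues is a linear
combination of the functions `γ_k` with `k < p^m`. -/
lemma indicator_residue (m : ℕ) (z : ZMod (p ^ m)) (x : Set.Ico (0 : ℝ) 1) :
    {x | residue p m x = z}.indicator (fun _ => (1 : ℂ)) x = ∑ k ∈ range (p ^ m),
      ((p : ℂ) ^ m)⁻¹ * ZMod.stdAddChar ((rev p m k : ZMod (p ^ m)) * z) *
        conj (gammaOne p k x) := by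
  have hp : (p : ℂ) ≠ 0 := by exact_mod_cast (Fact.out : p.Prime).ne_zero
  have hinj : Set.InjOn (fun k => (rev p m k : ZMod (p ^ m))) (range (p ^ m) : Set ℕ) := by
    intro k hk l hl h
    simp only [coe_range] at hk hl
    rw [ZMod.natCast_eq_natCast_iff', Nat.mod_eq_of_lt (rev_lt p m k),
      Nat.mod_eq_of_lt (rev_lt p m l)] at h
    exact rev_injOn p m hk hl h
  have himg : (range (p ^ m)).image (fun k => (rev p m k : ZMod (p ^ m))) = univ := by
    apply eq_univ_of_card
    rw [card_image_of_injOn hinj, card_range, ZMod.card]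
  have e : ∑ k ∈ range (p ^ m),
      ((p : ℂ) ^ m)⁻¹ * ZMod.stdAddChar ((rev p m k : ZMod (p ^ m)) * z) * conj (gammaOne p k x) =
      ((p : ℂ) ^ m)⁻¹ * ∑ b : ZMod (p ^ m), ZMod.stdAddChar ((z - residue p m x) * b) := by
    rw [← himg, sum_image hinj, mul_sum]
    refine sum_congr rfl fun k hk => ?_
    rw [gammaOne_eq_stdAddChar p (mem_range.mp hk), conj_stdAddChar, mul_assoc,
      ← AddChar.map_add_eq_mul]
    congr 2
    ring
  rw [e, sum_stdAddChar_mul, Set.indicator_apply]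
  simp only [Set.mem_ofPred_eq, sub_eq_zero, eq_comm (a := z)]
  split_ifs <;> simp [hp]

/-! ### Cells generate the Borel sets -/

/-- The sets of points in `[0,1)` with prescribed first digits in base `p`. -/
def cells : Set (Set (Set.Ico (0 : ℝ) 1)) :=
  {C | ∃ (m : ℕ) (z : ZMod (p ^ m)), C = {x | residue p m x = z}}

lemma isPiSystem_cells : IsPiSystem (cells p) := by
  have key : ∀ m n : ℕ, m ≤ n → ∀ (z : ZMod (p ^ m)) (w : ZMod (p ^ n)) (x : Set.Ico (0 : ℝ) 1),
      residue p m x = z → residue p n x = w →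
      {x | residue p n x = w} ⊆ {x | residue p m x = z} := by
    intro m n hmn z w x hz hw y hy
    simp only [Set.mem_ofPred_eq] at hy ⊢
    rw [← hz, ← cast_residue p hmn, ← cast_residue p hmn, hy, hw]
  rintro _ ⟨m, z, rfl⟩ _ ⟨n, w, rfl⟩ ⟨x, hx, hx'⟩
  rcases le_total m n with h | h
  · exact ⟨n, w, Set.inter_eq_right.mpr (key m n h z w x hx hx')⟩
  · exact ⟨m, z, Set.inter_eq_left.mpr (key n m h w z x hx' hx)⟩

/-- The cells generate the Borel sets, as each digit of `x` is determined by a residue and `x` is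
the limit of its finite expansions. -/
lemma generateFrom_cells :
    MeasurableSpace.generateFrom (cells p) =
      (inferInstance : MeasurableSpace (Set.Ico (0 : ℝ) 1)) := by
  refine le_antisymm (MeasurableSpace.generateFrom_le ?_) ?_
  · rintro _ ⟨m, z, rfl⟩
    exact measurableSet_residue p m z
  · have hval : ∀ m, Measurable[MeasurableSpace.generateFrom (cells p)]
        fun x : Set.Ico (0 : ℝ) 1 => (residue p m x).val := by
      intro m
      refine @measurable_to_countable' _ _ _ _ (_) _ fun j => ?_
      by_cases hj : j < p ^ m
      · refine MeasurableSpace.measurableSet_generateFrom ⟨m, (j : ZMod (p ^ m)), ?_⟩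
        ext x
        simp only [Set.mem_preimage, Set.mem_singleton_iff, Set.mem_ofPred_eq]
        rw [← (ZMod.val_injective (p ^ m)).eq_iff, ZMod.val_natCast, Nat.mod_eq_of_lt hj]
      · convert! @MeasurableSet.empty _ (MeasurableSpace.generateFrom (cells p))
        ext x
        simp only [Set.mem_preimage, Set.mem_singleton_iff, Set.mem_empty_iff_false, iff_false]
        exact fun h => hj (h ▸ ZMod.val_lt _)
    have hcoe : Measurable[MeasurableSpace.generateFrom (cells p)]
        (Subtype.val : Set.Ico (0 : ℝ) 1 → ℝ) := by
      refine @measurable_of_tendsto_metrizable _ _ (_) _ _ _ _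
        (fun n (x : Set.Ico (0 : ℝ) 1) => ∑ i ∈ range n, Real.ofDigitsTerm (Real.digits x p) i) _
        ?_ ?_
      · intro n
        simp only [Real.ofDigitsTerm, digits_eq_residue_div]
        refine @Finset.measurable_sum _ _ _ _ _ _ (_) _ _ fun i _ => ?_
        exact (measurable_from_top (f := fun j : ℕ =>
          ((j / p ^ i : ℕ) : ℝ) * ((p : ℝ) ^ (i + 1))⁻¹)).comp (hval (i + 1))
      · rw [tendsto_pi_nhds]
        exact fun x => (Real.hasSum_ofDigitsTerm_digits (x : ℝ)
          (Fact.out : p.Prime).one_lt x.2).tendsto_sum_nat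
    exact hcoe.comap_le

end OneDimensional

/-! ### Orthonormality and uniqueness of coefficients on the cube -/

lemma gammaOne_zero (q : ℕ) [Fact q.Prime] (x : Set.Ico (0 : ℝ) 1) : gammaOne q 0 x = 1 := by
  simp [gammaOne, chi, monna]

section SeveralVariables

variable {s : ℕ} (p : Fin s → Nat.Primes)

lemma gamma_zero (x : Cube s) : gamma p 0 x = 1 := by
  simp [gamma, gammaOne_zero]

lemma integral_gamma_mul_conj (k l : Fin s → ℕ) :
    ∫ x, gamma p l x * conj (gamma p k x) = if k = l then 1 else 0 := by
  simp only [gamma, map_prod, ← prod_mul_distrib]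
  rw [integral_fintype_prod_volume_eq_prod
    (f := fun i x => gammaOne (p i) (l i) x * conj (gammaOne (p i) (k i) x))]
  simp only [integral_gammaOne_mul_conj, prod_ite_zero, prod_const_one, mem_univ, true_implies,
    funext_iff]

/-- An integrable function, all of whose coefficients vanish, vanishes almost everywhere: its
integral over each product of cells is a linear combination of coefficients, and these products
form a `π`-system which generates the Borel sets. -/
lemma ae_eq_zero_of_coeff_eq_zero {f : Cube s → ℂ} (hf : Integrable f)
    (h0 : ∀ k, coeff p f k = 0) : f =ᵐ[volume] 0 := by
  have hbox : ∀ B ∈ Set.pi Set.univ '' Set.pi Set.univ fun i => cells (p i),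
      ∫ x in B, f x = 0 := by
    rintro _ ⟨C, hC, rfl⟩
    choose m z hmz using fun i => hC i (Set.mem_univ i)
    have hmeas : MeasurableSet (Set.pi Set.univ C) :=
      MeasurableSet.univ_pi fun i => hmz i ▸ measurableSet_residue _ _ _
    set c : ∀ i, ℕ → ℂ := fun i k => (((p i : ℕ) : ℂ) ^ m i)⁻¹ *
      ZMod.stdAddChar ((rev (p i) (m i) k : ZMod ((p i : ℕ) ^ m i)) * z i)
    have e : ∀ x, (Set.pi Set.univ C).indicator f x =
        ∑ k ∈ Fintype.piFinset fun i => range ((p i : ℕ) ^ m i),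
          (∏ i, c i (k i)) * (f x * conj (gamma p k x)) := by
      intro x
      have e1 : (Set.pi Set.univ C).indicator f x =
          f x * ∏ i, (C i).indicator (fun _ => (1 : ℂ)) (x i) := by
        by_cases hx : x ∈ Set.pi Set.univ C
        · rw [Set.indicator_of_mem hx, prod_eq_one, mul_one]
          exact fun i _ => Set.indicator_of_mem (hx i (Set.mem_univ i)) _
        · obtain ⟨i, hi⟩ : ∃ i, x i ∉ C i := by simpa [Set.mem_pi] using hx
          rw [Set.indicator_of_notMem hx, prod_eq_zero (mem_univ i)
            (Set.indicator_of_notMem hi _), mul_zero]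
      rw [e1]
      simp only [hmz, indicator_residue]
      rw [prod_univ_sum, mul_sum]
      refine sum_congr rfl fun k _ => ?_
      rw [gamma, map_prod, prod_mul_distrib]
      ring
    rw [← integral_indicator hmeas]
    simp only [e]
    rw [integral_finsetSum _ fun k _ => (integrable_mul_gamma p hf k).const_mul _]
    refine sum_eq_zero fun k _ => ?_
    rw [integral_const_mul]
    exact mul_eq_zero_of_right _ (h0 k)
  have hgen : (inferInstance : MeasurableSpace (Cube s)) = MeasurableSpace.generateFrom
      (Set.pi Set.univ '' Set.pi Set.univ fun i => cells (p i)) := by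
    refine (generateFrom_eq_pi (fun i => generateFrom_cells (p i)) fun i => ?_).symm
    refine ⟨fun _ => Set.univ, fun _ => ⟨0, 0, ?_⟩, Set.iUnion_const _⟩
    refine (Set.eq_univ_of_forall fun x => ?_).symm
    exact @Subsingleton.elim (ZMod ((p i : ℕ) ^ 0)) (by rw [pow_zero]; infer_instance) _ _
  have hall : ∫ x, f x = 0 := by simpa [coeff, gamma_zero] using h0 0
  refine hf.ae_eq_zero_of_forall_setIntegral_eq_zero fun B hB _ => ?_
  induction B, hB using MeasurableSpace.induction_on_inter hgen
    (IsPiSystem.pi fun i => isPiSystem_cells (p i)) with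
  | empty => simp
  | basic B hB => exact hbox B hB
  | compl B hB ih =>
    have := integral_add_compl hB hf
    simpa [ih, hall] using this
  | iUnion B hd hB ih =>
    rw [integral_iUnion hB hd hf.integrableOn]
    simp [ih]

end SeveralVariables

/-! ### Products of series and summability of the weights -/

/-- The product of finitely many absolutely convergent series, as a sum over all tuples of
indices. -/
lemma summable_norm_and_hasSum_prod {s : ℕ} (g : Fin s → ℕ → ℂ)
    (hg : ∀ i, Summable fun k => ‖g i k‖) :
    (Summable fun k : Fin s → ℕ => ‖∏ i, g i (k i)‖) ∧
      HasSum (fun k : Fin s → ℕ => ∏ i, g i (k i)) (∏ i, ∑' k, g i k) := by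
  induction s with
  | zero => simp [Summable.of_finite, hasSum_unique]
  | succ s ih =>
    obtain ⟨h1, h2⟩ := ih (fun i => g i.succ) fun i => hg i.succ
    rw [← (Fin.consEquiv fun _ : Fin (s + 1) => ℕ).summable_iff,
      ← (Fin.consEquiv fun _ : Fin (s + 1) => ℕ).hasSum_iff, Fin.prod_univ_succ]
    simp only [Function.comp_def, Fin.consEquiv, Equiv.coe_fn_mk, Fin.prod_univ_succ,
      Fin.cons_zero, Fin.cons_succ]
    have h3 : Summable fun x : ℕ × (Fin s → ℕ) => ‖g 0 x.1 * ∏ i : Fin s, g i.succ (x.2 i)‖ :=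
      (hg 0).mul_norm (g := fun k : Fin s → ℕ => ∏ i : Fin s, g i.succ (k i)) h1
    exact ⟨h3, HasSum.mul (f := g 0) (g := fun k : Fin s → ℕ => ∏ i : Fin s, g i.succ (k i))
      (hg 0).of_norm.hasSum h2 h3.of_norm⟩

lemma summable_prod {s : ℕ} {g : Fin s → ℕ → ℝ} (h0 : ∀ i k, 0 ≤ g i k)
    (hg : ∀ i, Summable (g i)) :
    Summable fun k : Fin s → ℕ => ∏ i, g i (k i) := by
  have := (summable_norm_and_hasSum_prod (fun i k => (g i k : ℂ)) fun i => by
    simpa [abs_of_nonneg (h0 i _)] using hg i).1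
  refine this.congr fun k => ?_
  rw [norm_prod]
  exact prod_congr rfl fun i _ => by rw [Complex.norm_real, Real.norm_of_nonneg (h0 i _)]

/-- If `q^t ≤ k < q^(t+1)`, then `ρ_q(k) = q^(-2t)` is at most `q² k^(-2)`. -/
lemma summable_rhoOne (q : ℕ) [Fact q.Prime] : Summable (rhoOne q) := by
  have h : Summable fun k : ℕ => (q : ℝ) ^ 2 * ((k : ℝ) ^ 2)⁻¹ :=
    (Real.summable_nat_pow_inv.mpr one_lt_two).mul_left _
  rw [← summable_nat_add_iff 1] at h ⊢
  refine Summable.of_nonneg_of_le (fun k => (rhoOne_pos q _).le) (fun k => ?_) h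
  have hq : (0 : ℝ) < q := by exact_mod_cast (Fact.out : q.Prime).pos
  have h1 : ((k + 1 : ℕ) : ℝ) ≤ (q : ℝ) ^ (Nat.log q (k + 1) + 1) := by
    exact_mod_cast (Nat.lt_pow_succ_log_self (Fact.out : q.Prime).one_lt (k + 1)).le
  have h2 : (0 : ℝ) < ((k + 1 : ℕ) : ℝ) := by positivity
  rw [rhoOne, if_neg k.succ_ne_zero, ← div_eq_mul_inv, le_div_iff₀ (by positivity),
    inv_mul_le_iff₀ (by positivity)]
  calc ((k + 1 : ℕ) : ℝ) ^ 2 ≤ ((q : ℝ) ^ (Nat.log q (k + 1) + 1)) ^ 2 := by gcongr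
    _ = _ := by ring

lemma summable_rho {s : ℕ} (p : Fin s → Nat.Primes) : Summable (rho p) :=
  summable_prod (fun _ _ => (rhoOne_pos _ _).le) fun i => summable_rhoOne (p i)

/-! ### The space as a weighted `ℓ²` space -/

section Synthesis

variable {s : ℕ} (p : Fin s → Nat.Primes)

lemma summable_norm_of_weighted {c : (Fin s → ℕ) → ℂ}
    (hc : Summable fun k => (rho p k)⁻¹ * ‖c k‖ ^ 2) : Summable fun k => ‖c k‖ := by
  refine Summable.of_nonneg_of_le (fun k => norm_nonneg _) (fun k => ?_) (hc.add (summable_rho p))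
  have h := rho_pos p k
  have e : (rho p k)⁻¹ * ‖c k‖ ^ 2 + rho p k - ‖c k‖ =
      (rho p k)⁻¹ * ((‖c k‖ - rho p k / 2) ^ 2 + 3 / 4 * rho p k ^ 2) := by
    field_simp
    ring
  have : 0 ≤ (rho p k)⁻¹ * ((‖c k‖ - rho p k / 2) ^ 2 + 3 / 4 * rho p k ^ 2) := by positivity
  linarith

lemma coeff_congr_ae {f g : Cube s → ℂ} (h : f =ᵐ[volume] g) (k : Fin s → ℕ) :
    coeff p f k = coeff p g k :=
  integral_congr_ae (h.mono fun x hx => by simp only [hx])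

namespace HSpace

lemma ext_coeff {f g : HSpace p} (h : ∀ k, coeff p f k = coeff p g k) : f = g := by
  refine DFunLike.ext _ _ fun x => (f.spec.2.2 x).unique ?_
  simpa only [h] using g.spec.2.2 x

/-- Every square-summable (with respect to the weights `ρ_p(k)⁻¹`) family is the family of
coefficients of an element of the space: as `|c_k| ≤ ρ_p(k)⁻¹ |c_k|² + ρ_p(k)`, the family is
absolutely summable, so that the series with these coefficients converges uniformly. -/
lemma exists_coeff_eq {c : (Fin s → ℕ) → ℂ} (hc : Summable fun k => (rho p k)⁻¹ * ‖c k‖ ^ 2) :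
    ∃ g : HSpace p, ∀ k, coeff p g k = c k := by
  have hc1 := summable_norm_of_weighted p hc
  have hsum : ∀ x, HasSum (fun k => c k * gamma p k x) (∑' k, c k * gamma p k x) := fun x =>
    (Summable.of_norm (by simpa [norm_gamma] using hc1)).hasSum
  set g : Cube s → ℂ := fun x => ∑' k, c k * gamma p k x
  have hmeas : Measurable g := by
    refine measurable_of_tendsto_metrizable'
      (f := fun (t : Finset (Fin s → ℕ)) x => ∑ k ∈ t, c k * gamma p k x) Filter.atTop
      (fun t => Finset.measurable_sum _ fun k _ => (measurable_gamma p k).const_mul _) ?_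
    rw [tendsto_pi_nhds]
    exact fun x => hsum x
  have hint : Integrable g := by
    refine Integrable.of_bound hmeas.aestronglyMeasurable (∑' k, ‖c k‖)
      (Filter.Eventually.of_forall fun x => ?_)
    refine (norm_tsum_le_tsum_norm (by simpa [norm_gamma] using hc1)).trans_eq ?_
    simp [norm_gamma]
  have hcoeff : ∀ k, coeff p g k = c k := by
    intro k
    have hi : ∀ l, Integrable fun x => c l * (gamma p l x * conj (gamma p k x)) := fun l => by
      refine Integrable.const_mul (integrable_mul_gamma p ?_ k) _
      exact Integrable.of_bound (measurable_gamma p l).aestronglyMeasurable 1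
        (Filter.Eventually.of_forall fun x => (norm_gamma p l x).le)
    have h := hasSum_integral_of_summable_integral_norm hi
      (by simpa [norm_gamma] using hc1)
    have e : ∀ x, ∑' l, c l * (gamma p l x * conj (gamma p k x)) = g x * conj (gamma p k x) :=
      fun x => by simp only [g, ← mul_assoc, tsum_mul_right]
    simp only [e, integral_const_mul, integral_gamma_mul_conj, mul_ite, mul_one, mul_zero] at h
    simpa [coeff] using h.unique (hasSum_single k fun l hl => if_neg hl.symm)
  refine ⟨⟨g, hint, ?_, ?_⟩, hcoeff⟩
  · simpa only [FiniteNorm, hcoeff] using hc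
  · simpa only [hcoeff] using hsum

lemma inner_eq_tsum (g f : HSpace p) : ⟪g, f⟫_ℂ =
    ∑' k : Fin s → ℕ, ((rho p k)⁻¹ : ℂ) * (coeff p f k * conj (coeff p g k)) := rfl

lemma norm_sq_eq_tsum (f : HSpace p) :
    ‖f‖ ^ 2 = ∑' k : Fin s → ℕ, (rho p k)⁻¹ * ‖coeff p f k‖ ^ 2 := by
  have h : ((‖f‖ ^ 2 : ℝ) : ℂ) =
      ((∑' k : Fin s → ℕ, (rho p k)⁻¹ * ‖coeff p f k‖ ^ 2 : ℝ) : ℂ) := by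
    rw [Complex.ofReal_tsum]
    push_cast
    rw [← Complex.coe_algebraMap, ← inner_self_eq_norm_sq_to_K (𝕜 := ℂ) f, inner_eq_tsum]
    exact tsum_congr fun k => by rw [Complex.mul_conj']; rfl
  exact_mod_cast h

lemma existsUnique_ae_eq {f : Cube s → ℂ} (hf : Integrable f) (hf' : FiniteNorm p f) :
    ∃! g : HSpace p, (g : Cube s → ℂ) =ᵐ[volume] f := by
  obtain ⟨g, hg⟩ := exists_coeff_eq p hf'
  refine ⟨g, ?_, fun g' hg' => ext_coeff p fun k => ?_⟩
  · have h := ae_eq_zero_of_coeff_eq_zero p (f := g + (-1 : ℂ) • f) (g.spec.1.add (hf.smul _))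
      fun k => by
        rw [coeff_add p g.spec.1 (hf.smul _), coeff_smul, hg]
        ring
    filter_upwards [h] with x hx
    simpa [← sub_eq_add_neg, sub_eq_zero] using hx
  · rw [hg, coeff_congr_ae p hg']

/-- The normalized coefficients `ρ_p(k)^(-1/2) f̂(k)`, as an element of `ℓ²`. -/
def toL2 : HSpace p →ₗ[ℂ] lp (fun _ : Fin s → ℕ => ℂ) 2 where
  toFun f := ⟨fun k => ((√(rho p k))⁻¹ : ℝ) * coeff p f k, by
    refine memℓp_gen (f.spec.2.1.congr fun k => ?_)
    simp [mul_pow, abs_of_nonneg, Real.sq_sqrt (rho_pos p k).le]⟩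
  map_add' f g := lp.ext <| funext fun k => by
    simp only [coe_add, coeff_add p f.spec.1 g.spec.1, mul_add]
    rfl
  map_smul' c f := lp.ext <| funext fun k => by
    simp only [coe_smul, coeff_smul, mul_left_comm _ c]
    rfl

lemma toL2_apply (f : HSpace p) (k : Fin s → ℕ) :
    toL2 p f k = ((√(rho p k))⁻¹ : ℝ) * coeff p f k := rfl

lemma inner_toL2 (f g : HSpace p) : ⟪toL2 p f, toL2 p g⟫_ℂ = ⟪f, g⟫_ℂ := by
  rw [lp.inner_eq_tsum, inner_eq_tsum]
  refine tsum_congr fun k => ?_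
  have h : ((√(rho p k) : ℝ) : ℂ) ^ 2 = rho p k := by
    exact_mod_cast congrArg Complex.ofReal (Real.sq_sqrt (rho_pos p k).le)
  rw [toL2_apply, toL2_apply, RCLike.inner_apply, map_mul, Complex.conj_ofReal, ← h]
  push_cast
  ring

lemma bijective_toL2 : Function.Bijective (toL2 p) := by
  have h0 : ∀ k, ((√(rho p k) : ℝ) : ℂ) ≠ 0 := fun k => by
    exact_mod_cast (Real.sqrt_pos.mpr (rho_pos p k)).ne'
  constructor
  · intro f g h
    refine ext_coeff p fun k => ?_
    have := congrArg (fun u : lp (fun _ : Fin s → ℕ => ℂ) 2 => u k) h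
    simpa [toL2_apply, h0 k] using this
  · intro u
    have hu : Summable fun k => (rho p k)⁻¹ * ‖((√(rho p k) : ℝ) : ℂ) * u k‖ ^ 2 := by
      refine ((lp.memℓp u).summable (by norm_num)).congr fun k => ?_
      have := (rho_pos p k).ne'
      rw [norm_mul, mul_pow, Complex.norm_real, Real.norm_eq_abs, sq_abs,
        Real.sq_sqrt (rho_pos p k).le, inv_mul_cancel_left₀ this]
      simp
    obtain ⟨g, hg⟩ := exists_coeff_eq p hu
    refine ⟨g, lp.ext <| funext fun k => ?_⟩
    rw [toL2_apply, hg]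
    push_cast
    exact inv_mul_cancel_left₀ (h0 k) _

lemma completeSpace : CompleteSpace (HSpace p) := by
  have e : HSpace p ≃ₗᵢ[ℂ] lp (fun _ : Fin s → ℕ => ℂ) 2 :=
    (LinearEquiv.ofBijective (toL2 p) (bijective_toL2 p)).isometryOfInner (inner_toL2 p)
  exact e.toIsometryEquiv.completeSpace

lemma exists_coe_eq_gamma (k : Fin s → ℕ) : ∃ g : HSpace p, ⇑g = gamma p k ∧
    ∀ f : HSpace p, ⟪g, f⟫_ℂ = ((rho p k)⁻¹ : ℂ) * coeff p f k := by
  classical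
  obtain ⟨g, hg⟩ := exists_coeff_eq p (c := fun l => if l = k then 1 else 0)
    (summable_of_ne_finset_zero (s := {k}) fun l hl => by simp_all)
  refine ⟨g, funext fun x => (g.spec.2.2 x).unique ?_, fun f => ?_⟩
  · simp only [hg, ite_mul, one_mul, zero_mul]
    convert! hasSum_ite_eq k (gamma p k x) using 2 with l
    split_ifs with h <;> simp [h]
  · rw [inner_eq_tsum, tsum_eq_single k fun l hl => by simp [hg, hl]]
    simp [hg]

end HSpace

/-! ### The reproducing kernel -/

lemma isReproducingKernel_kernel : IsReproducingKernel (HSpace p) (kernel p) := by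
  intro y
  have hc : Summable fun k => (rho p k)⁻¹ * ‖(rho p k : ℂ) * conj (gamma p k y)‖ ^ 2 := by
    refine (summable_rho p).congr fun k => ?_
    have := (rho_pos p k).ne'
    simp only [norm_mul, RCLike.norm_conj, norm_gamma, Complex.norm_real, Real.norm_eq_abs,
      mul_one, sq_abs]
    field_simp
  obtain ⟨g, hg⟩ := HSpace.exists_coeff_eq p hc
  refine ⟨g, fun x => ?_, fun f => ?_⟩
  · rw [← (g.spec.2.2 x).tsum_eq, kernel]
    refine tsum_congr fun k => ?_
    rw [hg]
    ring
  · rw [← (f.spec.2.2 y).tsum_eq, HSpace.inner_eq_tsum]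
    refine tsum_congr fun k => ?_
    have : (rho p k : ℂ) ≠ 0 := by exact_mod_cast (rho_pos p k).ne'
    rw [hg, map_mul, Complex.conj_ofReal, Complex.conj_conj]
    field_simp

end Synthesis

/-! ### Tensor products -/

section TensorProduct

/-- A natural number as an index in dimension one. -/
def constEquiv : ℕ ≃ (Fin 1 → ℕ) where
  toFun k _ := k
  invFun k := k 0
  left_inv _ := rfl
  right_inv _ := funext fun i => by rw [Subsingleton.elim i 0]

lemma constEquiv_apply (k : ℕ) : constEquiv k = fun _ => k := rfl

variable (q : Nat.Primes)

lemma gamma_const (k : ℕ) (x : Set.Ico (0 : ℝ) 1) :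
    gamma (fun _ : Fin 1 => q) (fun _ => k) (fun _ => x) = gammaOne q k x := by
  simp [gamma]

lemma rho_const (k : ℕ) : rho (fun _ : Fin 1 => q) (fun _ => k) = rhoOne q k := by
  simp [rho]

lemma funUnique_const (x : Cube 1) :
    (fun _ => MeasurableEquiv.funUnique (Fin 1) (Set.Ico (0 : ℝ) 1) x : Cube 1) = x :=
  funext fun i => by rw [Subsingleton.elim i 0]; rfl

lemma integrable_comp_const {f : Cube 1 → ℂ} (hf : Integrable f) :
    Integrable fun x : Set.Ico (0 : ℝ) 1 => f fun _ => x := by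
  have h := volume_preserving_funUnique (Fin 1) (Set.Ico (0 : ℝ) 1)
  refine (h.integrable_comp_emb (MeasurableEquiv.measurableEmbedding _)).mp ?_
  simp only [Function.comp_def, funUnique_const]
  exact hf

lemma coeff_const (f : Cube 1 → ℂ) (k : ℕ) :
    coeff (fun _ : Fin 1 => q) f (fun _ => k) =
      ∫ x : Set.Ico (0 : ℝ) 1, f (fun _ => x) * conj (gammaOne q k x) := by
  have h := volume_preserving_funUnique (Fin 1) (Set.Ico (0 : ℝ) 1)
  rw [← h.integral_comp']
  simp only [← gamma_const q, funUnique_const]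
  rfl

variable {s : ℕ} (p : Fin s → Nat.Primes)

lemma coeff_prod (f : Fin s → Cube 1 → ℂ) (k : Fin s → ℕ) :
    coeff p (fun x => ∏ i, f i fun _ => x i) k =
      ∏ i, coeff (fun _ : Fin 1 => p i) (f i) fun _ => k i := by
  simp only [coeff_const]
  simp only [coeff, gamma, map_prod, ← prod_mul_distrib]
  exact integral_fintype_prod_volume_eq_prod
    (f := fun i x => f i (fun _ => x) * conj (gammaOne (p i) (k i) x))

lemma exists_isPureTensor (f : ∀ i, HOne (p i)) : ∃ F : HSpace p, IsPureTensor p f F := by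
  refine ⟨⟨fun x => ∏ i, f i fun _ => x i, ?_, ?_, fun x => ?_⟩, fun x => rfl⟩
  · exact Integrable.fintype_prod (f := fun i x => f i fun _ => x)
      fun i => integrable_comp_const (f i).spec.1
  · have h : ∀ i, Summable fun k : ℕ =>
        (rhoOne (p i) k)⁻¹ * ‖coeff (fun _ : Fin 1 => p i) (f i) fun _ => k‖ ^ 2 := fun i => by
      simpa only [Function.comp_def, constEquiv_apply, rho_const] using
        constEquiv.summable_iff.mpr (f i).spec.2.1
    refine (summable_prod (fun i k => ?_) h).congr fun k => ?_
    · have := rhoOne_pos (p i) k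
      positivity
    · rw [coeff_prod, norm_prod, rho, prod_mul_distrib, prod_inv_distrib, prod_pow]
  · have h1 : ∀ i, Summable fun k : ℕ =>
        ‖coeff (fun _ : Fin 1 => p i) (f i) (fun _ => k) * gammaOne (p i) k (x i)‖ := fun i => by
      simpa only [Function.comp_def, constEquiv_apply, norm_mul, norm_gammaOne, mul_one] using
        constEquiv.summable_iff.mpr (summable_norm_of_weighted _ (f i).spec.2.1)
    have h2 : ∀ i, ∑' k : ℕ, coeff (fun _ : Fin 1 => p i) (f i) (fun _ => k) *
        gammaOne (p i) k (x i) = f i fun _ => x i := fun i => by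
      have := constEquiv.hasSum_iff.mpr ((f i).spec.2.2 fun _ => x i)
      simpa only [Function.comp_def, constEquiv_apply, gamma_const] using this.tsum_eq
    have h3 := (summable_norm_and_hasSum_prod _ h1).2
    simp only [h2] at h3
    convert! h3 using 2 with k
    rw [coeff_prod, prod_mul_distrib, gamma]

lemma inner_eq_prod_inner {f g : ∀ i, HOne (p i)} {F G : HSpace p} (hF : IsPureTensor p f F)
    (hG : IsPureTensor p g G) : ⟪F, G⟫_ℂ = ∏ i, ⟪f i, g i⟫_ℂ := by
  have h1 : ∀ i, Summable fun k : ℕ => ‖((rhoOne (p i) k)⁻¹ : ℂ) *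
      (coeff (fun _ : Fin 1 => p i) (g i) (fun _ => k) *
        conj (coeff (fun _ : Fin 1 => p i) (f i) fun _ => k))‖ := fun i => by
    have := constEquiv.summable_iff.mpr
      (FiniteNorm.summable_inner _ (f i).spec.2.1 (g i).spec.2.1).norm
    simpa only [Function.comp_def, constEquiv_apply, rho_const] using this
  have h2 : ∀ i, ∑' k : ℕ, ((rhoOne (p i) k)⁻¹ : ℂ) *
      (coeff (fun _ : Fin 1 => p i) (g i) (fun _ => k) *
        conj (coeff (fun _ : Fin 1 => p i) (f i) fun _ => k)) = ⟪f i, g i⟫_ℂ := fun i => by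
    rw [HSpace.inner_eq_tsum, ← constEquiv.tsum_eq]
    simp only [constEquiv_apply, rho_const]
  have h3 := (summable_norm_and_hasSum_prod _ h1).2.tsum_eq
  simp only [h2] at h3
  rw [← h3, HSpace.inner_eq_tsum]
  refine tsum_congr fun k => ?_
  rw [show ⇑F = _ from funext hF, show ⇑G = _ from funext hG, coeff_prod p (fun i => ⇑(f i)),
    coeff_prod p (fun i => ⇑(g i)), rho, prod_mul_distrib, prod_mul_distrib, map_prod,
    prod_inv_distrib]
  push_cast
  rfl

/-- The functions `γ_k` are product functions, and nothing but zero is orthogonal to all of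
them. -/
lemma dense_span_isPureTensor :
    Dense (Submodule.span ℂ {F : HSpace p | ∃ f, IsPureTensor p f F} : Set (HSpace p)) := by
  have := HSpace.completeSpace p
  rw [Submodule.dense_iff_topologicalClosure_eq_top, Submodule.topologicalClosure_eq_top_iff,
    Submodule.eq_bot_iff]
  intro f hf
  refine HSpace.ext_coeff p fun k => ?_
  obtain ⟨g, hg, hg'⟩ := HSpace.exists_coe_eq_gamma p k
  choose u hu _ using fun i => HSpace.exists_coe_eq_gamma (fun _ : Fin 1 => p i) fun _ => k i
  have hmem : g ∈ Submodule.span ℂ {F : HSpace p | ∃ f, IsPureTensor p f F} := by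
    refine Submodule.subset_span ⟨u, fun x => ?_⟩
    simp only [hg, hu, gamma_const]
    rfl
  have h : (rho p k : ℂ) ≠ 0 := by exact_mod_cast (rho_pos p k).ne'
  have h0 := (hg' f).symm.trans ((Submodule.mem_orthogonal _ _).mp hf g hmem)
  have h1 : coeff p f k = 0 := by simpa [h] using h0
  rw [h1]
  exact (by simp [coeff] : coeff p (0 : Cube s → ℂ) k = 0).symm

lemma isTensorProduct : IsTensorProduct p :=
  ⟨exists_isPureTensor p, fun _ _ _ _ => inner_eq_prod_inner p, dense_span_isPureTensor p⟩

end TensorProduct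

/-! ### The worst-case error -/

section WorstCaseError

/-- The norm of the functional `⟪h, ·⟫` is `‖h‖`, as a supremum in `[0, ∞]`. -/
lemma iSup_ofReal_norm_inner {H : Type*} [NormedAddCommGroup H] [InnerProductSpace ℂ H] (h : H) :
    ⨆ (f : H) (_ : ‖f‖ ≤ 1), ENNReal.ofReal ‖⟪h, f⟫_ℂ‖ = ENNReal.ofReal ‖h‖ := by
  refine le_antisymm (iSup₂_le fun f hf => ENNReal.ofReal_le_ofReal ?_) ?_
  · exact (norm_inner_le_norm h f).trans (mul_le_of_le_one_right (norm_nonneg h) hf)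
  · rcases eq_or_ne h 0 with rfl | h0
    · simp
    · have hn := norm_ne_zero_iff.mpr h0
      have hu : ‖((‖h‖⁻¹ : ℝ) : ℂ) • h‖ ≤ 1 := by
        rw [norm_smul, Complex.norm_real, norm_inv, norm_norm, inv_mul_cancel₀ hn]
      refine le_iSup₂_of_le (((‖h‖⁻¹ : ℝ) : ℂ) • h) hu (ENNReal.ofReal_le_ofReal ?_)
      rw [inner_smul_right, norm_mul, inner_self_eq_norm_sq_to_K, Complex.norm_real, norm_inv,
        norm_norm, norm_pow]
      simp only [Complex.coe_algebraMap, Complex.norm_real, norm_norm]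
      rw [sq, inv_mul_cancel_left₀ hn]

variable {s : ℕ} (p : Fin s → Nat.Primes)

lemma one_lt_sigma (hs : 1 ≤ s) : 1 < sigma p := by
  have : Nonempty (Fin s) := ⟨⟨0, hs⟩⟩
  calc (1 : ℝ) = ∏ _i : Fin s, (1 : ℝ) := by simp
    _ < sigma p := prod_lt_prod_of_nonempty (fun _ _ => one_pos)
        (fun i _ => by have := (p i).2.pos; simpa using this) univ_nonempty

/-- The quadrature error is a bounded functional on the space. It is represented by the function
with coefficients `-ρ_p(k) conj(S_k)` for `k ≠ 0`, where `S_k` is the mean of `γ_k` over the first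
`N` points; the coefficient at `0` vanishes since constants are integrated exactly. -/
lemma exists_representer (ω : ℕ → Cube s) {N : ℕ} (hN : 1 ≤ N) : ∃ h : HSpace p,
    (∀ f : HSpace p, ⟪h, f⟫_ℂ = (∫ x, f x) - (1 / (N : ℂ)) * ∑ n ∈ range N, f (ω n)) ∧
    ‖h‖ ^ 2 = ∑' k : {k : Fin s → ℕ // k ≠ 0},
      rho p k * ‖(1 / (N : ℂ)) * ∑ n ∈ range N, gamma p k (ω n)‖ ^ 2 := by
  classical
  have hN0 : (N : ℂ) ≠ 0 := by exact_mod_cast (Nat.one_le_iff_ne_zero.mp hN)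
  set S : (Fin s → ℕ) → ℂ := fun k => (1 / (N : ℂ)) * ∑ n ∈ range N, gamma p k (ω n) with hS
  have hS0 : S 0 = 1 := by simp [hS, gamma_zero, hN0]
  have hS1 : ∀ k, ‖S k‖ ≤ 1 := fun k => by
    have h : ‖∑ n ∈ range N, gamma p k (ω n)‖ ≤ N := by
      simpa [norm_gamma] using norm_sum_le (range N) fun n => gamma p k (ω n)
    have hN' : (0 : ℝ) < N := by exact_mod_cast hN
    rw [hS, norm_mul, norm_div, norm_one, Complex.norm_natCast, one_div, inv_mul_le_one₀ hN']
    exact h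
  set c : (Fin s → ℕ) → ℂ := fun k => rho p k * conj ((if k = 0 then 1 else 0) - S k) with hc
  have hterm : ∀ k, (rho p k)⁻¹ * ‖c k‖ ^ 2 =
      ({0}ᶜ : Set (Fin s → ℕ)).indicator (fun k => rho p k * ‖S k‖ ^ 2) k := by
    intro k
    have := (rho_pos p k).ne'
    by_cases hk : k = 0
    · subst hk
      simp [hc, hS0]
    · rw [Set.indicator_of_mem (by simpa using hk)]
      simp only [hc, if_neg hk, zero_sub, map_neg, norm_mul, norm_neg, RCLike.norm_conj,
        Complex.norm_real, Real.norm_eq_abs, mul_pow, sq_abs]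
      field_simp
  have hsum : Summable fun k => (rho p k)⁻¹ * ‖c k‖ ^ 2 := by
    simp only [hterm]
    refine Summable.indicator (Summable.of_nonneg_of_le (fun k => ?_) (fun k => ?_)
      (summable_rho p)) _
    · have := rho_pos p k
      positivity
    · exact mul_le_of_le_one_right (rho_pos p k).le (pow_le_one₀ (norm_nonneg _) (hS1 k))
  obtain ⟨h, hh⟩ := HSpace.exists_coeff_eq p hsum
  refine ⟨h, fun f => ?_, ?_⟩
  · have h1 : HasSum (fun k => coeff p f k * if k = 0 then 1 else 0) (∫ x, f x) := by
      have e : coeff p f 0 = ∫ x, f x := by simp [coeff, gamma_zero]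
      rw [← e]
      simp only [mul_ite, mul_one, mul_zero]
      convert! hasSum_ite_eq (0 : Fin s → ℕ) (coeff p f 0) using 2 with k
      split_ifs with hk <;> simp [hk]
    have h2 : HasSum (fun k => coeff p f k * S k) ((1 / (N : ℂ)) * ∑ n ∈ range N, f (ω n)) := by
      convert! (hasSum_sum fun n (_ : n ∈ range N) => f.spec.2.2 (ω n)).mul_left (1 / (N : ℂ))
        using 2 with k
      rw [hS, ← mul_sum]
      ring
    rw [← (h1.sub h2).tsum_eq, HSpace.inner_eq_tsum]
    refine tsum_congr fun k => ?_
    have : (rho p k : ℂ) ≠ 0 := by exact_mod_cast (rho_pos p k).ne'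
    rw [hh, hc, map_mul, Complex.conj_ofReal, Complex.conj_conj]
    field_simp
  · rw [HSpace.norm_sq_eq_tsum]
    simp only [hh, hterm]
    exact (tsum_subtype ({0}ᶜ : Set (Fin s → ℕ)) fun k => rho p k * ‖S k‖ ^ 2).symm

lemma worstCaseError_eq (hs : 1 ≤ s) (ω : ℕ → Cube s) {N : ℕ} (hN : 1 ≤ N) :
    worstCaseError (HSpace p) ω N =
      ENNReal.ofReal (Real.sqrt (sigma p - 1) * diaphony p ω N) := by
  obtain ⟨h, h1, h2⟩ := exists_representer p ω hN
  have hσ : 0 < sigma p - 1 := sub_pos.mpr (one_lt_sigma p hs)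
  simp only [worstCaseError, ← h1]
  rw [iSup_ofReal_norm_inner, diaphony, ← Real.sqrt_mul hσ.le, ← h2, ← mul_assoc,
    mul_one_div_cancel hσ.ne', one_mul, Real.sqrt_sq (norm_nonneg h)]

end WorstCaseError

end PadicDiaphony

end

theorem proposition1 {s : ℕ} (hs : 1 ≤ s) (p : Fin s → Nat.Primes) :
    -- the space is a Hilbert space
    CompleteSpace (PadicDiaphony.HSpace p) ∧
    -- up to null sets, it consists of all integrable functions of finite norm
    (∀ f : PadicDiaphony.Cube s → ℂ, Integrable f → PadicDiaphony.FiniteNorm p f →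
      ∃! g : PadicDiaphony.HSpace p, (g : PadicDiaphony.Cube s → ℂ) =ᵐ[volume] f) ∧
    -- it is the tensor product of the one-dimensional spaces
    PadicDiaphony.IsTensorProduct p ∧
    -- the series which define the kernel and the diaphony converge
    Summable (PadicDiaphony.rho p) ∧
    -- the reproducing kernel
    PadicDiaphony.IsReproducingKernel (PadicDiaphony.HSpace p) (PadicDiaphony.kernel p) ∧
    -- the worst-case error and the diaphony
    ∀ (ω : ℕ → PadicDiaphony.Cube s) (N : ℕ), 1 ≤ N →
      PadicDiaphony.worstCaseError (PadicDiaphony.HSpace p) ω N =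
        ENNReal.ofReal (Real.sqrt (PadicDiaphony.sigma p - 1) * PadicDiaphony.diaphony p ω N) := by
  exact ⟨PadicDiaphony.HSpace.completeSpace p,
    fun _ => PadicDiaphony.HSpace.existsUnique_ae_eq p, PadicDiaphony.isTensorProduct p,
    PadicDiaphony.summable_rho p, PadicDiaphony.isReproducingKernel_kernel p,
    fun ω _ hN => PadicDiaphony.worstCaseError_eq p hs ω hN⟩
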